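/- Let $(e_n)_{n\in\mathbb Z}$ be the canonical orthonormal basis of the complex Hilbert space $\ell^2(\mathbb Z)$. A bounded linear operator $T$ on $\ell^2(\mathbb Z)$ is a bilateral weighted shift if there are weights $w_n>0$ $(n\in\mathbb Z)$ with $Te_n=w_ne_{n+1}$ for all $n$, or $Te_n=w_ne_{n-1}$ for all $n$. For a vector $x$ put $\mathrm{Orb}(T,x)=\{T^nx:n\ge 0\}$. The operator $T$ is hypercyclic if $\mathrm{Orb}(T,x)$ is dense for some $x$; it is $M$-hypercyclic, for a closed subspace $M$, if $\mathrm{Orb}(T,x)\cap M$ is dense in $M$ for some $x\in\ell^2(\mathbb Z)$. Call $T$ a Salas shift if $T$ is a bilateral weighted shift such that both $T$ and its adjoint $T^*$ are hypercyclic. Then Salas shifts exist, and for every Salas shift $T$ both $T$ and $T^*$ are subspace-hypercyclic: there are closed subspaces $M_1,M_2$ of $\ell^2(\mathbb Z)$ (possibly different), each different from $\{0\}$ and from $\ell^2(\mathbb Z)$, such that $T$ is $M_1$-hypercyclic and $T^*$ is $M_2$-hypercyclic. In particular, Herrero's question (is there an operator such that both it and its adjoint are hypercyclic?) has a positive answer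 also for subspace-hypercyclicity. -/

import Mathlib

/-- The complex Hilbert space `ℓ²(ℤ)`. -/
abbrev EllTwoZ : Type := lp (fun _ : ℤ => ℂ) 2

/-- The canonical orthonormal basis vectors `e n` of `ℓ²(ℤ)`. -/
noncomputable def basisVec (n : ℤ) : EllTwoZ := lp.single 2 n (1 : ℂ)

section Hypercyclicity

variable {H : Type*} [NormedAddCommGroup H] [InnerProductSpace ℂ H]

/-- The orbit `{T ^ n x : n ≥ 0}` of `x` under the bounded linear operator `T`. -/
def orbit (T : H →L[ℂ] H) (x : H) : Set H := Set.range fun n : ℕ => (T ^ n) x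

/-- `T` is hypercyclic: some orbit of `T` is dense. -/
def IsHypercyclic (T : H →L[ℂ] H) : Prop := ∃ x : H, Dense (orbit T x)

/-- `T` is `M`-hypercyclic: for some `x` in the whole space, the set `orbit T x ∩ M` is dense
in `M`. -/
def IsHypercyclicFor (T : H →L[ℂ] H) (M : Submodule ℂ H) : Prop :=
  ∃ x : H, (M : Set H) ⊆ closure (orbit T x ∩ (M : Set H))

/-- `T` is subspace-hypercyclic: it is `M`-hypercyclic for a nontrivial closed subspace `M`,
that is, one different from `{0}` and from the whole space. -/
def IsSubspaceHypercyclic (T : H →L[ℂ] H) : Prop :=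
  ∃ M : Submodule ℂ H, IsClosed (M : Set H) ∧ M ≠ ⊥ ∧ M ≠ ⊤ ∧ IsHypercyclicFor T M

end Hypercyclicity

/-- `T` is a (forward or backward) bilateral weighted shift on `ℓ²(ℤ)` with positive weights `w`.
The weights are automatically bounded since `T` is. -/
def IsBilateralWeightedShift (T : EllTwoZ →L[ℂ] EllTwoZ) : Prop :=
  ∃ w : ℤ → ℝ, (∀ n, 0 < w n) ∧
    ((∀ n, T (basisVec n) = (w n : ℂ) • basisVec (n + 1)) ∨
      (∀ n, T (basisVec n) = (w n : ℂ) • basisVec (n - 1)))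

/-- `T` is a shift as in Salas's answer to Herrero's question: a bilateral weighted shift
such that both `T` and its Hilbert space adjoint are hypercyclic. -/
def IsSalasShift (T : EllTwoZ →L[ℂ] EllTwoZ) : Prop :=
  IsBilateralWeightedShift T ∧ IsHypercyclic T ∧ IsHypercyclic (ContinuousLinearMap.adjoint T)

/-!
A dense set `A` in an infinite-dimensional inner product space approximates every vector, so one can
choose `x n ∈ A` recursively with `x n = y n + 2⁻ⁿ • u n`, where `y n` is a prescribed combination
`x i + q • x j` of earlier terms and `u n` is as close as we like to `g n`, for an orthonormal
sequence `g`. If each combination with `q` in a countable dense set of scalars is prescribed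
infinitely often, it is a limit of the `x n`; hence the closure of `{x n}` is a subspace `M`, in
which `A ∩ M` is dense. A unit vector orthogonal to all `g n` stays at positive distance from the
span of the `u n`, so `M` is proper. With an orbit as `A`, hypercyclicity implies
subspace-hypercyclicity.

For the existence of Salas shifts, let `s : ℤ → ℝ` be an even Lipschitz potential that is unbounded
above and below. The shift `e n ↦ exp (s (n + 1) - s n) • e (n + 1)` has `k`-th power
`e n ↦ exp (s (n + k) - s n) • e (n + k)`, which, like its inverse, tends to zero on the basis along
any `k` with `s k → -∞`: this is the hypercyclicity criterion. The adjoint is the backward shift of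
the same kind with potential `-s`.
-/

open Filter Topology
open scoped NNReal ENNReal

section DenseSets

variable {𝕜 E : Type*} [RCLike 𝕜]

theorem span_subset_closure_of_add_smul_mem [AddCommGroup E] [Module 𝕜 E] [TopologicalSpace E]
    [ContinuousAdd E] [ContinuousSMul 𝕜 E] {S : Set E} (hS : S.Nonempty) {Q : Set 𝕜}
    (hQ : Dense Q) (h : ∀ a ∈ S, ∀ q ∈ Q, ∀ b ∈ S, a + q • b ∈ closure S) :
    (Submodule.span 𝕜 S : Set E) ⊆ closure S := by
  have add_smul_mem : ∀ a ∈ closure S, ∀ c : 𝕜, ∀ b ∈ closure S, a + c • b ∈ closure S := by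
    intro a ha c b hb
    have hcont : Continuous fun z : E × 𝕜 × E => z.1 + z.2.1 • z.2.2 := by fun_prop
    have hmem : (a, c, b) ∈ closure (S ×ˢ Q ×ˢ S) := by
      simp only [closure_prod_eq, Set.mem_prod]
      exact ⟨ha, hQ c, hb⟩
    simpa only [closure_closure] using map_mem_closure hcont hmem
      fun z hz => h z.1 hz.1 z.2.1 hz.2.1 z.2.2 hz.2.2
  obtain ⟨a₀, ha₀⟩ := hS
  have zero_mem : (0 : E) ∈ closure S := by
    simpa using add_smul_mem a₀ (subset_closure ha₀) (-1) a₀ (subset_closure ha₀)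
  intro x hx
  induction hx using Submodule.span_induction with
  | mem x hx => exact subset_closure hx
  | zero => exact zero_mem
  | add x y _ _ hx hy => simpa using add_smul_mem x hx 1 y hy
  | smul c x _ hx => simpa using add_smul_mem 0 zero_mem c x hx

section Construction

variable [NormedAddCommGroup E] [NormedSpace 𝕜 E]

theorem exists_norm_sub_lt_add_smul_mem_of_dense {A : Set E} (hA : Dense A) (y g : E) {δ : 𝕜}
    (hδ : δ ≠ 0) {ε : ℝ} (hε : 0 < ε) : ∃ u : E, ‖u - g‖ < ε ∧ y + δ • u ∈ A := by
  let affine : E ≃ₜ E := (Homeomorph.smulOfNeZero δ hδ).trans (Homeomorph.addLeft y)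
  obtain ⟨u, hu, hdist⟩ := (hA.preimage affine.isOpenMap).exists_dist_lt g hε
  exact ⟨u, by rwa [← dist_eq_norm, dist_comm], hu⟩

theorem exists_seq_eq_add_smul_mem_of_dense {A : Set E} (hA : Dense A)
    (target : ∀ n : ℕ, (∀ m < n, E) → E) (g : ℕ → E) {δ : ℕ → 𝕜} (hδ : ∀ n, δ n ≠ 0)
    {ε : ℕ → ℝ} (hε : ∀ n, 0 < ε n) :
    ∃ x u : ℕ → E, ∀ n, x n ∈ A ∧ ‖u n - g n‖ < ε n ∧
      x n = target n (fun m _ => x m) + δ n • u n := by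
  choose u hu hmem using fun n y =>
    exists_norm_sub_lt_add_smul_mem_of_dense hA y (g n) (hδ n) (hε n)
  let x : ℕ → E := Nat.strongRec fun n f => target n f + δ n • u n (target n f)
  have hx : ∀ n, x n = target n (fun m _ => x m) + δ n • u n (target n fun m _ => x m) :=
    fun n => Nat.strongRec_eq _ n
  exact ⟨x, fun n => u n (target n fun m _ => x m), fun n =>
    ⟨hx n ▸ hmem n _, hu n _, hx n⟩⟩

/-- The linear combination of terms of index at most `n` of a sequence `f` that an enumeration of
triples prescribes for the next term: if `n` codes `((i, j), (l, m))`, it is `f i + q l • f j`.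
The component `m` is a dummy which makes every triple `(i, j, l)` occur infinitely often. -/
def prescribedCombination (q : ℕ → 𝕜) : ∀ n : ℕ, (∀ m < n, E) → E
  | 0, _ => 0
  | n + 1, f =>
    f n.unpair.1.unpair.1
        (Nat.lt_succ_of_le ((Nat.unpair_left_le _).trans (Nat.unpair_left_le n))) +
      q n.unpair.2.unpair.1 • f n.unpair.1.unpair.2
        (Nat.lt_succ_of_le ((Nat.unpair_right_le _).trans (Nat.unpair_left_le n)))

theorem prescribedCombination_pair_succ (q : ℕ → 𝕜) (x : ℕ → E) (i j l m : ℕ) :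
    prescribedCombination q (Nat.pair (Nat.pair i j) (Nat.pair l m) + 1) (fun k _ => x k) =
      x i + q l • x j := by
  simp [prescribedCombination]

theorem mem_span_of_eq_prescribedCombination_add {q δ : ℕ → 𝕜} {x u : ℕ → E}
    (hx : ∀ n, x n = prescribedCombination q n (fun m _ => x m) + δ n • u n) (n : ℕ) :
    x n ∈ Submodule.span 𝕜 (Set.range u) := by
  induction n using Nat.strong_induction_on with
  | _ n ih =>
    rw [hx n]
    refine add_mem ?_ (Submodule.smul_mem _ _ (Submodule.subset_span ⟨n, rfl⟩))
    cases n with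
    | zero => exact zero_mem _
    | succ n =>
      simp only [prescribedCombination]
      exact add_mem (ih _ (by grind [Nat.unpair_left_le]))
        (Submodule.smul_mem _ _ (ih _ (by grind [Nat.unpair_left_le, Nat.unpair_right_le])))

theorem add_smul_mem_closure_range_of_eq_prescribedCombination_add {q : ℕ → 𝕜} {x v : ℕ → E}
    (hx : ∀ n, x n = prescribedCombination q n (fun m _ => x m) + v n)
    (hv : Tendsto v atTop (𝓝 0)) (i j l : ℕ) :
    x i + q l • x j ∈ closure (Set.range x) := by
  let N : ℕ → ℕ := fun m => Nat.pair (Nat.pair i j) (Nat.pair l m) + 1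
  have hN : Tendsto N atTop atTop :=
    Function.Injective.nat_tendsto_atTop fun m m' h => by simpa [N] using h
  have hlim : Tendsto (fun m => x (N m)) atTop (𝓝 (x i + q l • x j)) := by
    have hxN : ∀ m, x (N m) = x i + q l • x j + v (N m) := fun m => by
      rw [hx (N m), prescribedCombination_pair_succ]
    simpa only [hxN, add_zero, Function.comp_apply] using (hv.comp hN).const_add _
  exact mem_closure_of_tendsto hlim (Eventually.of_forall fun m => ⟨N m, rfl⟩)

theorem exists_seq_span_subset_closure_range_of_dense {A : Set E} (hA : Dense A) {g : ℕ → E}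
    {C : ℝ} (hg : ∀ n, ‖g n‖ ≤ C) {r : ℝ} (hr : 0 < r) :
    ∃ x u : ℕ → E, (∀ n, x n ∈ A) ∧ (∀ s : Finset ℕ, ∑ n ∈ s, ‖u n - g n‖ ≤ r) ∧ x 0 = u 0 ∧
      Submodule.span 𝕜 (Set.range x) ≤ Submodule.span 𝕜 (Set.range u) ∧
      (Submodule.span 𝕜 (Set.range x) : Set E) ⊆ closure (Set.range x) := by
  let q : ℕ → 𝕜 := TopologicalSpace.denseSeq 𝕜
  let δ : ℕ → 𝕜 := fun n => 2⁻¹ ^ n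
  have δ_tendsto : Tendsto δ atTop (𝓝 0) :=
    tendsto_pow_atTop_nhds_zero_of_norm_lt_one (by simpa using inv_lt_one_of_one_lt₀ one_lt_two)
  obtain ⟨x, u, hxu⟩ := exists_seq_eq_add_smul_mem_of_dense hA (prescribedCombination q) g
    (δ := δ) (fun n => pow_ne_zero n (inv_ne_zero two_ne_zero))
    (ε := fun n => r / 2 / 2 ^ n) (fun n => by positivity)
  choose hxA hu hx using hxu
  have hsum : ∀ s : Finset ℕ, ∑ n ∈ s, ‖u n - g n‖ ≤ r := fun s =>
    (Finset.sum_le_sum fun n _ => (hu n).le).trans <|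
      ((summable_geometric_two' r).sum_le_tsum s fun n _ => by positivity).trans_eq
        (tsum_geometric_two' r)
  have u_le : ∀ n, ‖u n‖ ≤ C + r := fun n =>
    (norm_le_norm_add_norm_sub' (u n) (g n)).trans
      (add_le_add (hg n) (by simpa using hsum {n}))
  have hsmall : Tendsto (fun n => δ n • u n) atTop (𝓝 0) :=
    δ_tendsto.zero_smul_isBoundedUnder_le (isBoundedUnder_of ⟨C + r, u_le⟩)
  refine ⟨x, u, hxA, hsum, by simpa [prescribedCombination, δ] using hx 0,
    Submodule.span_le.2 (Set.range_subset_iff.2 (mem_span_of_eq_prescribedCombination_add hx)),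
    span_subset_closure_of_add_smul_mem (Set.range_nonempty x)
      (TopologicalSpace.denseRange_denseSeq 𝕜) ?_⟩
  rintro _ ⟨i, rfl⟩ _ ⟨l, rfl⟩ _ ⟨j, rfl⟩
  exact add_smul_mem_closure_range_of_eq_prescribedCombination_add hx hsmall i j l

end Construction

variable [NormedAddCommGroup E] [InnerProductSpace 𝕜 E]

theorem exists_orthonormal_nat_of_not_finiteDimensional (hE : ¬FiniteDimensional 𝕜 E) :
    ∃ v : ℕ → E, Orthonormal 𝕜 v := by
  let b := Module.Basis.ofVectorSpace 𝕜 E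
  have : Infinite (Module.Basis.ofVectorSpaceIndex 𝕜 E) :=
    not_finite_iff_infinite.1 fun _ => hE (Module.Finite.of_basis b)
  exact ⟨_, InnerProductSpace.gramSchmidtNormed_orthonormal
    (b.linearIndependent.comp _ (Infinite.natEmbedding _).injective)⟩

theorem one_sub_le_norm_sub_of_mem_span {ι : Type*} {g u : ι → E} {h v : E} {r : ℝ}
    (hg : Orthonormal 𝕜 g) (hh : ‖h‖ = 1) (hgh : ∀ i, inner 𝕜 h (g i) = 0)
    (hu : ∀ s : Finset ι, ∑ i ∈ s, ‖u i - g i‖ ≤ r)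
    (hv : v ∈ Submodule.span 𝕜 (Set.range u)) : 1 - r ≤ ‖h - v‖ := by
  obtain ⟨c, rfl⟩ := Finsupp.mem_span_range_iff_exists_finsupp.1 hv
  set w : E := c.sum fun i a => a • g i with hw
  have inner_h_w : inner 𝕜 h w = 0 := by
    simp only [hw, Finsupp.sum, inner_sum, inner_smul_right, hgh, mul_zero,
      Finset.sum_const_zero]
  have one_le : 1 ≤ ‖h - w‖ := by
    simpa [inner_sub_right, inner_h_w, inner_self_eq_norm_sq_to_K, hh]
      using norm_inner_le_norm (𝕜 := 𝕜) h (h - w)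
  have coeff_le : ∀ i, ‖c i‖ ≤ ‖h - w‖ := fun i => by
    have inner_g_w : inner 𝕜 (g i) w = c i := by
      simpa only [Finsupp.linearCombination_apply] using hg.inner_right_finsupp c i
    have inner_g_h : inner 𝕜 (g i) h = 0 := inner_eq_zero_symm.1 (hgh i)
    simpa [inner_sub_right, inner_g_w, inner_g_h, hg.1 i]
      using norm_inner_le_norm (𝕜 := 𝕜) (g i) (h - w)
  have perturbation_le : ‖(c.sum fun i a => a • u i) - w‖ ≤ ‖h - w‖ * r := calc
    ‖(c.sum fun i a => a • u i) - w‖ = ‖∑ i ∈ c.support, c i • (u i - g i)‖ := by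
      simp only [hw, Finsupp.sum, smul_sub, Finset.sum_sub_distrib]
    _ ≤ ∑ i ∈ c.support, ‖h - w‖ * ‖u i - g i‖ := norm_sum_le_of_le _ fun i _ => by
      rw [norm_smul]
      gcongr
      exact coeff_le i
    _ ≤ ‖h - w‖ * r := by
      rw [← Finset.mul_sum]
      gcongr
      exact hu _
  have triangle : ‖h - w‖ ≤ ‖h - c.sum fun i a => a • u i‖ +
      ‖(c.sum fun i a => a • u i) - w‖ := norm_sub_le_norm_sub_add_norm_sub _ _ _
  rcases le_total r 1 with hr | hr
  · nlinarith
  · linarith [norm_nonneg (h - c.sum fun i a => a • u i)]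

theorem notMem_topologicalClosure_span_of_sum_norm_sub_le {ι : Type*} {g u : ι → E} {h : E}
    {r : ℝ} (hg : Orthonormal 𝕜 g) (hh : ‖h‖ = 1) (hgh : ∀ i, inner 𝕜 h (g i) = 0)
    (hu : ∀ s : Finset ι, ∑ i ∈ s, ‖u i - g i‖ ≤ r) (hr : r < 1) :
    h ∉ (Submodule.span 𝕜 (Set.range u)).topologicalClosure := by
  intro hmem
  have hfar : closure (Submodule.span 𝕜 (Set.range u) : Set E) ⊆ {v | 1 - r ≤ ‖h - v‖} :=
    closure_minimal (fun v hv => one_sub_le_norm_sub_of_mem_span hg hh hgh hu hv)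
      (isClosed_le (by fun_prop) (by fun_prop))
  have hself : 1 - r ≤ ‖h - h‖ := hfar hmem
  rw [sub_self, norm_zero] at hself
  linarith

theorem exists_isClosed_submodule_subset_closure_inter_of_dense (hE : ¬FiniteDimensional 𝕜 E)
    {A : Set E} (hA : Dense A) :
    ∃ M : Submodule 𝕜 E, IsClosed (M : Set E) ∧ M ≠ ⊥ ∧ M ≠ ⊤ ∧
      (M : Set E) ⊆ closure (A ∩ (M : Set E)) := by
  obtain ⟨v, hv⟩ := exists_orthonormal_nat_of_not_finiteDimensional hE
  have hg : Orthonormal 𝕜 fun n => v (n + 1) := hv.comp _ (add_left_injective 1)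
  obtain ⟨x, u, hxA, hsum, hxu, hspan, hclosure⟩ :=
    exists_seq_span_subset_closure_range_of_dense (𝕜 := 𝕜) hA (fun n => (hg.1 n).le)
      (one_half_pos (α := ℝ))
  let M := (Submodule.span 𝕜 (Set.range x)).topologicalClosure
  have hxM : Set.range x ⊆ M := Submodule.subset_span.trans subset_closure
  refine ⟨M, Submodule.isClosed_topologicalClosure _, fun hbot => ?_, fun htop => ?_, ?_⟩
  · have hu0 : u 0 = 0 := hxu ▸ (Submodule.mem_bot 𝕜).1 (hbot ▸ hxM ⟨0, rfl⟩)
    have : ‖u 0 - v 1‖ ≤ 1 / 2 := by simpa using hsum {0}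
    rw [hu0, zero_sub, norm_neg, hv.1] at this
    norm_num at this
  · have hv0 : v 0 ∈ M := htop.symm ▸ Submodule.mem_top
    exact notMem_topologicalClosure_span_of_sum_norm_sub_le hg (hv.1 0)
      (fun n => hv.2 n.succ_ne_zero.symm) hsum one_half_lt_one
      (Submodule.topologicalClosure_mono hspan hv0)
  · calc (M : Set E) ⊆ closure (Set.range x) := closure_minimal hclosure isClosed_closure
      _ ⊆ closure (A ∩ M) :=
        closure_mono (Set.subset_inter (Set.range_subset_iff.2 hxA) hxM)

end DenseSets

theorem IsHypercyclic.isSubspaceHypercyclic {H : Type*} [NormedAddCommGroup H]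
    [InnerProductSpace ℂ H] (hH : ¬FiniteDimensional ℂ H) {T : H →L[ℂ] H}
    (hT : IsHypercyclic T) : IsSubspaceHypercyclic T := by
  obtain ⟨x, hx⟩ := hT
  obtain ⟨M, hclosed, hbot, htop, hM⟩ :=
    exists_isClosed_submodule_subset_closure_inter_of_dense hH hx
  exact ⟨M, hclosed, hbot, htop, x, hM⟩

section Criterion

theorem exists_denseRange_apply_of_transitive {X Y ι : Type*} [TopologicalSpace X] [BaireSpace X]
    [Nonempty X] [TopologicalSpace Y] [SecondCountableTopology Y] {f : ι → X → Y}
    (hf : ∀ i, Continuous (f i))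
    (h : ∀ U V, IsOpen U → U.Nonempty → IsOpen V → V.Nonempty → ∃ i, (U ∩ f i ⁻¹' V).Nonempty) :
    ∃ x, DenseRange fun i => f i x := by
  let B := TopologicalSpace.countableBasis Y
  have isOpen_of_mem : ∀ V : B, IsOpen (V : Set Y) := fun V =>
    TopologicalSpace.isOpen_of_mem_countableBasis V.2
  have dense_iInter : Dense (⋂ V : B, ⋃ i, f i ⁻¹' V) := by
    refine dense_iInter_of_isOpen
      (fun V => isOpen_iUnion fun i => (isOpen_of_mem V).preimage (hf i)) fun V => ?_
    refine dense_iff_inter_open.2 fun U hU hU' => ?_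
    obtain ⟨i, x, hxU, hxV⟩ := h U V hU hU' (isOpen_of_mem V)
      (TopologicalSpace.nonempty_of_mem_countableBasis V.2)
    exact ⟨x, hxU, Set.mem_iUnion.2 ⟨i, hxV⟩⟩
  obtain ⟨x, hx⟩ := dense_iInter.nonempty
  refine ⟨x, (TopologicalSpace.isBasis_countableBasis Y).dense_iff.2 fun V hV _ => ?_⟩
  obtain ⟨i, hi⟩ := Set.mem_iUnion.1 (Set.mem_iInter.1 hx ⟨V, hV⟩)
  exact ⟨f i x, hi, i, rfl⟩

theorem isHypercyclic_of_tendsto {H ι : Type*} [NormedAddCommGroup H] [InnerProductSpace ℂ H]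
    [CompleteSpace H] [TopologicalSpace.SeparableSpace H] {T : H →L[ℂ] H} {l : Filter ι} [l.NeBot]
    {n : ι → ℕ} {S : ι → H → H} {X₀ Y₀ : Set H} (hX₀ : Dense X₀) (hY₀ : Dense Y₀)
    (hT : ∀ x ∈ X₀, Tendsto (fun i => (T ^ n i) x) l (𝓝 0))
    (hS : ∀ y ∈ Y₀, Tendsto (fun i => S i y) l (𝓝 0))
    (hTS : ∀ y ∈ Y₀, Tendsto (fun i => (T ^ n i) (S i y)) l (𝓝 y)) : IsHypercyclic T := by
  have : SecondCountableTopology H := UniformSpace.secondCountable_of_separable H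
  refine exists_denseRange_apply_of_transitive (fun k => (T ^ k).continuous)
    fun U V hU hU' hV hV' => ?_
  obtain ⟨x, hxU, hx⟩ := hX₀.inter_open_nonempty U hU hU'
  obtain ⟨y, hyV, hy⟩ := hY₀.inter_open_nonempty V hV hV'
  have tendsto_x : Tendsto (fun i => x + S i y) l (𝓝 x) := by
    simpa only [add_zero] using (hS y hy).const_add x
  have tendsto_y : Tendsto (fun i => (T ^ n i) (x + S i y)) l (𝓝 y) := by
    simpa only [map_add, zero_add] using (hT x hx).add (hTS y hy)
  obtain ⟨i, hiU, hiV⟩ := ((tendsto_x.eventually_mem (hU.mem_nhds hxU)).and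
    (tendsto_y.eventually_mem (hV.mem_nhds hyV))).exists
  exact ⟨n i, x + S i y, hiU, hiV⟩

theorem tendsto_apply_zero_of_mem_span {𝕜 E F ι : Type*} [Semiring 𝕜] [AddCommMonoid E]
    [Module 𝕜 E] [AddCommMonoid F] [Module 𝕜 F] [TopologicalSpace F] [ContinuousAdd F]
    [ContinuousConstSMul 𝕜 F] {l : Filter ι} {A : ι → E →ₗ[𝕜] F} {D : Set E}
    (hA : ∀ d ∈ D, Tendsto (fun i => A i d) l (𝓝 0)) {x : E} (hx : x ∈ Submodule.span 𝕜 D) :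
    Tendsto (fun i => A i x) l (𝓝 0) := by
  induction hx using Submodule.span_induction with
  | mem d hd => exact hA d hd
  | zero => simpa only [map_zero] using tendsto_const_nhds
  | add x y _ _ hx hy => simpa only [map_add, add_zero] using hx.add hy
  | smul c x _ hx => simpa only [map_smul, smul_zero] using hx.const_smul c

end Criterion

section Basis

/-- The canonical Hilbert basis of `ℓ²(ℤ)`, whose vectors are the `basisVec n`. -/
noncomputable def basisVecHilbertBasis : HilbertBasis ℤ ℂ EllTwoZ :=
  HilbertBasis.ofRepr (LinearIsometryEquiv.refl ℂ EllTwoZ)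

theorem coe_basisVecHilbertBasis : ⇑basisVecHilbertBasis = basisVec := by
  classical
  ext1 n
  rw [← basisVecHilbertBasis.repr_symm_single n]
  rfl

theorem orthonormal_basisVec : Orthonormal ℂ basisVec :=
  coe_basisVecHilbertBasis ▸ basisVecHilbertBasis.orthonormal

theorem dense_span_basisVec : Dense (Submodule.span ℂ (Set.range basisVec) : Set EllTwoZ) :=
  coe_basisVecHilbertBasis ▸
    Submodule.dense_iff_topologicalClosure_eq_top.2 basisVecHilbertBasis.dense_span

instance : TopologicalSpace.SeparableSpace EllTwoZ := by
  refine TopologicalSpace.isSeparable_univ_iff.1 ?_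
  rw [← dense_span_basisVec.closure_eq]
  exact ((Set.countable_range basisVec).isSeparable.span (R := ℂ)).closure

theorem not_finiteDimensional_ellTwoZ : ¬FiniteDimensional ℂ EllTwoZ := fun _ =>
  not_finite_iff_infinite.2 (inferInstanceAs (Infinite ℤ))
    orthonormal_basisVec.linearIndependent.finite

end Basis

section Translation

variable {ι κ 𝕜 E : Type*} [NormedAddCommGroup E]

theorem hasSum_norm_sq_comp_equiv (σ : κ ≃ ι) (x : lp (fun _ : ι => E) 2) :
    HasSum (fun k => ‖x (σ k)‖ ^ (2 : ℝ≥0∞).toReal) (‖x‖ ^ (2 : ℝ≥0∞).toReal) :=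
  σ.hasSum_iff.2 (lp.hasSum_norm (by norm_num) x)

variable [NormedField 𝕜] [NormedSpace 𝕜 E]

variable (𝕜) in
/-- The isometry `x ↦ x ∘ σ` between `ℓ²` spaces induced by a bijection `σ` of the index sets. -/
def ellTwoReindex (σ : κ ≃ ι) : lp (fun _ : ι => E) 2 →ₗᵢ[𝕜] lp (fun _ : κ => E) 2 where
  toFun x := ⟨fun k => x (σ k), memℓp_gen (hasSum_norm_sq_comp_equiv σ x).summable⟩
  map_add' _ _ := rfl
  map_smul' _ _ := rfl
  norm_map' x := by
    refine Real.rpow_left_injOn (x := (2 : ℝ≥0∞).toReal) (by norm_num) (norm_nonneg _)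
      (norm_nonneg _) ?_
    exact (lp.hasSum_norm (by norm_num) _).unique (hasSum_norm_sq_comp_equiv σ x)

end Translation

section Shifts

variable {K : ℝ≥0} {s : ℤ → ℝ}

theorem sub_sub_le_of_lipschitzWith (hs : LipschitzWith K s) (d n : ℤ) :
    s n - s (n - d) ≤ K * |(d : ℝ)| := by
  simpa only [Real.dist_eq, Int.dist_eq, Int.cast_sub, sub_sub_cancel] using
    (le_abs_self _).trans (hs.dist_le_mul n (n - d))

theorem memℓp_infty_exp_sub (hs : LipschitzWith K s) (d : ℤ) :
    Memℓp (fun n : ℤ => (Real.exp (s n - s (n - d)) : ℂ)) ∞ := by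
  refine memℓp_infty ⟨Real.exp (K * |(d : ℝ)|), Set.forall_mem_range.2 fun n => ?_⟩
  rw [Complex.norm_real, Real.norm_eq_abs, Real.abs_exp, Real.exp_le_exp]
  exact sub_sub_le_of_lipschitzWith hs d n

/-- The bounded operator `e n ↦ exp (s (n + d) - s n) • e (n + d)` on `ℓ²(ℤ)`: the translation by
`d`, conjugated by the possibly unbounded diagonal operator `e n ↦ exp (s n) • e n`. It is encoded
as a translation followed by a bounded diagonal operator. -/
noncomputable def potentialShift (hs : LipschitzWith K s) (d : ℤ) : EllTwoZ →L[ℂ] EllTwoZ :=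
  let weights : lp (fun _ : ℤ => ℂ) ∞ := ⟨_, memℓp_infty_exp_sub hs d⟩
  lp.holderL 2 (fun _ => ContinuousLinearMap.mul ℂ ℂ) (K := 1)
      (fun _ => ContinuousLinearMap.opNorm_mul_le ℂ ℂ) weights ∘L
    (ellTwoReindex ℂ (Equiv.subRight d)).toContinuousLinearMap

theorem potentialShift_apply (hs : LipschitzWith K s) (d : ℤ) (x : EllTwoZ) (n : ℤ) :
    potentialShift hs d x n = (Real.exp (s n - s (n - d)) : ℂ) * x (n - d) := rfl

theorem potentialShift_basisVec (hs : LipschitzWith K s) (d n : ℤ) :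
    potentialShift hs d (basisVec n) =
      (Real.exp (s (n + d) - s n) : ℂ) • basisVec (n + d) := by
  ext m
  rw [potentialShift_apply, lp.coeFn_smul, Pi.smul_apply, smul_eq_mul, basisVec, basisVec,
    lp.single_apply, lp.single_apply]
  rcases eq_or_ne m (n + d) with rfl | hm
  · simp
  · rw [Pi.single_eq_of_ne hm, Pi.single_eq_of_ne (by lia), mul_zero, mul_zero]

theorem potentialShift_zero (hs : LipschitzWith K s) : potentialShift hs 0 = 1 := by
  ext x n
  simp [potentialShift_apply]

theorem potentialShift_mul (hs : LipschitzWith K s) (d d' : ℤ) :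
    potentialShift hs d * potentialShift hs d' = potentialShift hs (d + d') := by
  ext x n
  rw [mul_apply_eq_comp, potentialShift_apply, potentialShift_apply,
    potentialShift_apply, ← mul_assoc, ← Complex.ofReal_mul, ← Real.exp_add, sub_sub,
    sub_add_sub_cancel]

theorem potentialShift_pow (hs : LipschitzWith K s) (d : ℤ) (k : ℕ) :
    potentialShift hs d ^ k = potentialShift hs (k * d) := by
  induction k with
  | zero => rw [pow_zero, Nat.cast_zero, zero_mul, potentialShift_zero]
  | succ k ih => rw [pow_succ, ih, potentialShift_mul, Nat.cast_succ, add_one_mul]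

theorem adjoint_potentialShift (hs : LipschitzWith K s) (d : ℤ) :
    ContinuousLinearMap.adjoint (potentialShift hs d) = potentialShift hs.neg (-d) := by
  refine ((ContinuousLinearMap.eq_adjoint_iff _ _).2 fun x y => ?_).symm
  rw [lp.inner_eq_tsum, lp.inner_eq_tsum, ← (Equiv.subRight d).tsum_eq]
  refine tsum_congr fun n => ?_
  simp only [Equiv.subRight_apply, potentialShift_apply, RCLike.inner_apply, map_mul,
    Complex.conj_ofReal, sub_neg_eq_add, sub_add_cancel, Pi.neg_apply]
  rw [neg_add_eq_sub]
  ring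

theorem tendsto_potentialShift_basisVec {ι : Type*} {l : Filter ι} (hs : LipschitzWith K s)
    {k : ι → ℤ} (hk : Tendsto (fun i => s (k i)) l atBot) (n : ℤ) :
    Tendsto (fun i => potentialShift hs (k i) (basisVec n)) l (𝓝 0) := by
  refine squeeze_zero_norm (a := fun i => Real.exp (s (k i) + (K * |(n : ℝ)| - s n))) (fun i => ?_)
    (Real.tendsto_exp_atBot.comp (tendsto_atBot_add_const_right _ _ hk))
  rw [potentialShift_basisVec, norm_smul, orthonormal_basisVec.1, mul_one, Complex.norm_real,
    Real.norm_eq_abs, Real.abs_exp, Real.exp_le_exp]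
  have hle := sub_sub_le_of_lipschitzWith hs n (n + k i)
  rw [add_sub_cancel_left] at hle
  linarith

theorem isHypercyclic_potentialShift {ι : Type*} {l : Filter ι} [l.NeBot]
    (hs : LipschitzWith K s) {d : ℤ} {n : ι → ℕ}
    (hpos : Tendsto (fun i => s (n i * d)) l atBot)
    (hneg : Tendsto (fun i => s (-(n i * d))) l atBot) : IsHypercyclic (potentialShift hs d) := by
  have tendsto_zero : ∀ {k : ι → ℤ}, Tendsto (fun i => s (k i)) l atBot →
      ∀ x ∈ Submodule.span ℂ (Set.range basisVec),
        Tendsto (fun i => potentialShift hs (k i) x) l (𝓝 0) := fun hk x hx =>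
    tendsto_apply_zero_of_mem_span (A := fun i => (potentialShift hs _ : EllTwoZ →ₗ[ℂ] EllTwoZ))
      (Set.forall_mem_range.2 (tendsto_potentialShift_basisVec hs hk)) hx
  have right_inverse : ∀ i y,
      (potentialShift hs d ^ n i) (potentialShift hs (-(n i * d)) y) = y := fun i y => by
    rw [potentialShift_pow, ← mul_apply_eq_comp, potentialShift_mul, add_neg_cancel,
      potentialShift_zero, one_apply_eq_self]
  refine isHypercyclic_of_tendsto (n := n) (S := fun i => potentialShift hs (-(n i * d)))
    dense_span_basisVec dense_span_basisVec ?_ (tendsto_zero hneg) fun y _ => ?_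
  · simpa only [potentialShift_pow, SetLike.mem_coe] using tendsto_zero hpos
  · simpa only [right_inverse] using tendsto_const_nhds

theorem isSalasShift_potentialShift_one {ι κ : Type*} {l : Filter ι} {l' : Filter κ} [l.NeBot]
    [l'.NeBot] (hs : LipschitzWith K s) (heven : ∀ n, s (-n) = s n) {n : ι → ℕ} {m : κ → ℕ}
    (hbot : Tendsto (fun i => s (n i)) l atBot) (htop : Tendsto (fun i => s (m i)) l' atTop) :
    IsSalasShift (potentialShift hs 1) := by
  refine ⟨⟨fun n => Real.exp (s (n + 1) - s n), fun n => Real.exp_pos _,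
    Or.inl (potentialShift_basisVec hs 1)⟩, ?_, ?_⟩
  · exact isHypercyclic_potentialShift hs (n := n) (by simpa only [mul_one] using hbot)
      (by simpa only [mul_one, heven] using hbot)
  · rw [adjoint_potentialShift]
    have hbot' : Tendsto (fun i => -s (m i)) l' atBot := tendsto_neg_atTop_atBot.comp htop
    exact isHypercyclic_potentialShift hs.neg (n := m)
      (by simpa only [mul_neg_one, Pi.neg_apply, heven] using hbot')
      (by simpa only [mul_neg_one, neg_neg, Pi.neg_apply] using hbot')

end Shifts

section Oscillation

theorem abs_mul_sin_sub_mul_sin_le {a b : ℝ} (hb : 0 ≤ b) (hba : b ≤ a) :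
    |a * Real.sin a - b * Real.sin b| ≤ a ^ 2 - b ^ 2 := calc
  |a * Real.sin a - b * Real.sin b|
      = |(a - b) * Real.sin a + b * (Real.sin a - Real.sin b)| := by ring_nf
  _ ≤ |(a - b) * Real.sin a| + |b * (Real.sin a - Real.sin b)| := abs_add_le _ _
  _ ≤ (a - b) * a + b * (a - b) := by
    rw [abs_mul, abs_mul, abs_of_nonneg hb, abs_of_nonneg (sub_nonneg.2 hba)]
    gcongr
    · exact Real.abs_sin_le_abs.trans_eq (abs_of_nonneg (hb.trans hba))
    · exact (Real.abs_sin_sub_sin_le a b).trans_eq (abs_of_nonneg (sub_nonneg.2 hba))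
  _ = a ^ 2 - b ^ 2 := by ring

/-- An even Lipschitz function on `ℝ` which oscillates between arbitrarily large positive and
negative values. The square root makes up for the growth of the slopes of `t ↦ t * sin t`. -/
noncomputable def sqrtOscillation (t : ℝ) : ℝ := √|t| * Real.sin √|t|

theorem sqrtOscillation_neg (t : ℝ) : sqrtOscillation (-t) = sqrtOscillation t := by
  rw [sqrtOscillation, sqrtOscillation, abs_neg]

theorem lipschitzWith_sqrtOscillation : LipschitzWith 1 sqrtOscillation := by
  have le_of_abs_le : ∀ {t t' : ℝ}, |t'| ≤ |t| →
      |sqrtOscillation t - sqrtOscillation t'| ≤ |t - t'| := fun {t t'} h => calc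
    |sqrtOscillation t - sqrtOscillation t'| ≤ √|t| ^ 2 - √|t'| ^ 2 :=
      abs_mul_sin_sub_mul_sin_le (Real.sqrt_nonneg _) (Real.sqrt_le_sqrt h)
    _ = |t| - |t'| := by rw [Real.sq_sqrt (abs_nonneg _), Real.sq_sqrt (abs_nonneg _)]
    _ ≤ |t - t'| := abs_sub_abs_le_abs_sub _ _
  refine LipschitzWith.of_dist_le_mul fun t t' => ?_
  rw [NNReal.coe_one, one_mul, Real.dist_eq, Real.dist_eq]
  rcases le_total |t'| |t| with h | h
  · exact le_of_abs_le h
  · rw [abs_sub_comm, abs_sub_comm t]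
    exact le_of_abs_le h

theorem sqrtOscillation_sq_add_nat_mul_two_pi {θ : ℝ} (hθ : 0 ≤ θ) (i : ℕ) :
    sqrtOscillation ((θ + i * (2 * Real.pi)) ^ 2) = (θ + i * (2 * Real.pi)) * Real.sin θ := by
  rw [sqrtOscillation, abs_of_nonneg (sq_nonneg _), Real.sqrt_sq (by positivity),
    Real.sin_add_nat_mul_two_pi]

theorem abs_apply_natFloor_sub_le_of_lipschitzWith {K : ℝ≥0} {f : ℝ → ℝ} (hf : LipschitzWith K f)
    {t : ℝ} (ht : 0 ≤ t) : |f ⌊t⌋₊ - f t| ≤ K := by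
  have dist_floor_le : dist (⌊t⌋₊ : ℝ) t ≤ 1 :=
    abs_le.2 ⟨by linarith [Nat.lt_floor_add_one t], by linarith [Nat.floor_le ht]⟩
  calc |f ⌊t⌋₊ - f t| ≤ K * dist (⌊t⌋₊ : ℝ) t := hf.dist_le_mul _ _
    _ ≤ K := mul_le_of_le_one_right K.2 dist_floor_le

theorem tendsto_add_nat_mul_two_pi (θ : ℝ) :
    Tendsto (fun i : ℕ => θ + i * (2 * Real.pi)) atTop atTop :=
  tendsto_atTop_add_const_left _ _ (tendsto_natCast_atTop_atTop.atTop_mul_const Real.two_pi_pos)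

theorem exists_tendsto_sqrtOscillation_natCast_atTop :
    ∃ k : ℕ → ℕ, Tendsto (fun i => sqrtOscillation (k i)) atTop atTop := by
  let θ := Real.pi / 2
  have hθ : 0 ≤ θ := by positivity
  refine ⟨fun i => ⌊(θ + i * (2 * Real.pi)) ^ 2⌋₊, tendsto_atTop_mono (fun i => ?_)
    (tendsto_atTop_add_const_right _ (-1) (tendsto_add_nat_mul_two_pi θ))⟩
  have hfloor := abs_apply_natFloor_sub_le_of_lipschitzWith lipschitzWith_sqrtOscillation
    (sq_nonneg (θ + i * (2 * Real.pi)))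
  rw [sqrtOscillation_sq_add_nat_mul_two_pi hθ, Real.sin_pi_div_two, mul_one] at hfloor
  exact add_neg_le_iff_le_add.2 (neg_le_sub_iff_le_add.1 (neg_le_of_abs_le hfloor))

theorem exists_tendsto_sqrtOscillation_natCast_atBot :
    ∃ k : ℕ → ℕ, Tendsto (fun i => sqrtOscillation (k i)) atTop atBot := by
  let θ := Real.pi / 2 + Real.pi
  have hθ : 0 ≤ θ := by positivity
  refine ⟨fun i => ⌊(θ + i * (2 * Real.pi)) ^ 2⌋₊, tendsto_atBot_mono (fun i => ?_)
    (tendsto_atBot_add_const_right _ 1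
      (tendsto_neg_atTop_atBot.comp (tendsto_add_nat_mul_two_pi θ)))⟩
  have hfloor := abs_apply_natFloor_sub_le_of_lipschitzWith lipschitzWith_sqrtOscillation
    (sq_nonneg (θ + i * (2 * Real.pi)))
  rw [sqrtOscillation_sq_add_nat_mul_two_pi hθ, Real.sin_add_pi, Real.sin_pi_div_two,
    mul_neg_one] at hfloor
  exact sub_le_iff_le_add'.1 (le_of_abs_le hfloor)

end Oscillation

theorem exists_isSalasShift : ∃ T : EllTwoZ →L[ℂ] EllTwoZ, IsSalasShift T := by
  obtain ⟨k, hk⟩ := exists_tendsto_sqrtOscillation_natCast_atBot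
  obtain ⟨m, hm⟩ := exists_tendsto_sqrtOscillation_natCast_atTop
  have lipschitz : LipschitzWith (1 * 1) fun n : ℤ => sqrtOscillation n :=
    lipschitzWith_sqrtOscillation.comp Real.isometry_intCast.lipschitz
  exact ⟨potentialShift lipschitz 1, isSalasShift_potentialShift_one lipschitz
    (fun n => by rw [Int.cast_neg, sqrtOscillation_neg])
    (by simpa only [Int.cast_natCast] using hk) (by simpa only [Int.cast_natCast] using hm)⟩

theorem mainTheorem6_general :
    (∃ T : EllTwoZ →L[ℂ] EllTwoZ, IsSalasShift T) ∧
      ∀ {H : Type*} [NormedAddCommGroup H] [InnerProductSpace ℂ H], ¬FiniteDimensional ℂ H →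
        ∀ T : H →L[ℂ] H, IsHypercyclic T → IsSubspaceHypercyclic T :=
  ⟨exists_isSalasShift, fun hH _ hT => hT.isSubspaceHypercyclic hH⟩

theorem mainTheorem6 :
    (∃ T : EllTwoZ →L[ℂ] EllTwoZ, IsSalasShift T) ∧
      ∀ T : EllTwoZ →L[ℂ] EllTwoZ, IsSalasShift T →
        IsSubspaceHypercyclic T ∧ IsSubspaceHypercyclic (ContinuousLinearMap.adjoint T) := by
  obtain ⟨hexists, hsubspace⟩ := mainTheorem6_general
  exact ⟨hexists, fun T hT => ⟨hsubspace not_finiteDimensional_ellTwoZ T hT.2.1,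
    hsubspace not_finiteDimensional_ellTwoZ _ hT.2.2⟩⟩
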